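/- Let $R$ and $S$ be two-sided Noetherian rings and let $l:R\to S$ be a Frobenius extension, i.e. a unital ring homomorphism such that ${}_RS$ is finitely generated projective and ${}_SS_R\cong \mathrm{Hom}_R({}_RS_S,{}_RR_R)$ as $S$-$R$-bimodules. Assume that ${}_RS_R$ is centrally projective over $R$, i.e. ${}_RS_R$ is a direct summand of a finite direct sum of copies of ${}_RR_R$ as an $R$-$R$-bimodule. Let $n\ge 0$ be an integer and let $\omega$ be a finitely generated left $R$-module with $\mathrm{fadim}_R\,\omega\ge n+2$ and $\mathrm{Ext}^i_R(\omega,\omega)=0$ for $1\le i\le n$. Let $M$ be a finitely generated left $S$-module, regarded also as an $R$-module through $l$. Then $M$ is $(S\otimes_R\omega)$-$n$-torsionfree as an $S$-module if and only if $M$ is $\omega$-$n$-torsionfree as an $R$-module; and this holds whichever presentations are used to compute the two transposes. Here $\mathrm{add}\,\omega$ is the class of modules isomorphic to direct summands of finite direct sums of copies of $\omega$. A homomorphism $A\to X$ is a left $\mathrm{add}\,\omega$-approximation if $X\in\mathrm{add}\,\omega$ and every homomorphism from $A$ to a module in $\mathrm{add}\,\omega$ factors through it. We write $\mathrm{fadim}_R\,\omega\ge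 m$ if there is an exact sequence $0\to R\xrightarrow{f_1}X_1\xrightarrow{f_2}\cdots\xrightarrow{f_m}X_m$ such that each inclusion $\mathrm{Im} f_i\to X_i$ is a left $\mathrm{add}\,\omega$-approximation. For a finitely generated left $R$-module $N$ and an exact sequence $P_1\xrightarrow{d}P_0\to N\to 0$ with $P_0,P_1$ finitely generated projective, $\mathrm{Tr}_\omega N$ is the cokernel of $\mathrm{Hom}_R(d,\omega):\mathrm{Hom}_R(P_0,\omega)\to\mathrm{Hom}_R(P_1,\omega)$, a right module over $T=\mathrm{End}_R(\omega)$, where $T$ acts on $\omega$ from the right. The module $N$ is $\omega$-$n$-torsionfree if $\mathrm{Ext}^i_{T^{\mathrm{op}}}(\mathrm{Tr}_\omega N,\omega)=0$ for $1\le i\le n$, Ext being taken over right $T$-modules. For $S$-modules and $S\otimes_R\omega$ the same definitions are used with $\mathrm{End}_S(S\otimes_R\omega)$ in place of $T$. -/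

import Mathlib

open CategoryTheory
open scoped TensorProduct

universe u

namespace RelTorsionfree

section Approximations

variable (R : Type u) [Ring R] (ω : Type u) [AddCommGroup ω] [Module R ω]

/-- `X` lies in `add ω`: it is (isomorphic to) a direct summand of a finite direct sum of copies
of `ω`. -/
def InAdd (X : Type u) [AddCommGroup X] [Module R X] : Prop :=
  ∃ (k : ℕ) (i : X →ₗ[R] (Fin k → ω)) (p : (Fin k → ω) →ₗ[R] X), p ∘ₗ i = LinearMap.id

/-- `f : A → X` is a left `add ω`-approximation: `X` lies in `add ω` and every homomorphism from `A`
to a module in `add ω` factors through `f`. -/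
def IsLeftAddApproximation {A X : Type u} [AddCommGroup A] [Module R A] [AddCommGroup X]
    [Module R X] (f : A →ₗ[R] X) : Prop :=
  InAdd R ω X ∧ ∀ (Y : Type u) [AddCommGroup Y] [Module R Y], InAdd R ω Y →
    ∀ g : A →ₗ[R] Y, ∃ h : X →ₗ[R] Y, h ∘ₗ f = g

/-- `fadim_R ω ≥ m`: there is an exact sequence `0 → R → X 1 → ⋯ → X m` in which each inclusion
`Im (f i) → X (i + 1)` is a left `add ω`-approximation (in particular `X (i + 1)` lies in `add ω`).
Here `X 0` is a copy of `R` and the map `f i` goes from `X i` to `X (i + 1)`; nothing is required of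
the terms `X i` with `i > m`, nor of the maps `f i` with `m ≤ i` when `m ≥ 1`. -/
def FaithfulDimGE (m : ℕ) : Prop :=
  ∃ (X : ℕ → ModuleCat.{u} R) (_ : R ≃ₗ[R] X 0) (f : ∀ i, X i →ₗ[R] X (i + 1)),
    Function.Injective (f 0) ∧
    (∀ i, i + 1 < m → Function.Exact (f i) (f (i + 1))) ∧
    ∀ i, i < m → IsLeftAddApproximation R ω (LinearMap.range (f i)).subtype

end Approximations

section Transpose

/-- An exact sequence `P₁ → P₀ → M → 0` of left `R`-modules with `P₀` and `P₁` finitely generated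
projective. -/
structure ProjPresentation (R : Type u) [Ring R] (M : Type u) [AddCommGroup M] [Module R M] where
  P₁ : ModuleCat.{u} R
  P₀ : ModuleCat.{u} R
  finite₁ : Module.Finite R P₁
  finite₀ : Module.Finite R P₀
  projective₁ : Module.Projective R P₁
  projective₀ : Module.Projective R P₀
  d : P₁ →ₗ[R] P₀
  aug : P₀ →ₗ[R] M
  exact : Function.Exact d aug
  surjective : Function.Surjective aug

variable {R : Type u} [Ring R]

/-- A finitely generated module over a left Noetherian ring has a presentation by finitely generated
projective modules. -/
theorem ProjPresentation.nonempty [IsNoetherianRing R] (M : Type u) [AddCommGroup M] [Module R M]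
    [Module.Finite R M] : Nonempty (ProjPresentation R M) := by
  obtain ⟨a, g, hg⟩ := Module.Finite.exists_fin' R M
  obtain ⟨b, h, hh⟩ := Module.Finite.exists_fin' R (LinearMap.ker g)
  exact ⟨{
    P₁ := ModuleCat.of R (Fin b → R)
    P₀ := ModuleCat.of R (Fin a → R)
    finite₁ := inferInstanceAs (Module.Finite R (Fin b → R))
    finite₀ := inferInstanceAs (Module.Finite R (Fin a → R))
    projective₁ := inferInstanceAs (Module.Projective R (Fin b → R))
    projective₀ := inferInstanceAs (Module.Projective R (Fin a → R))
    d := (LinearMap.ker g).subtype ∘ₗ h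
    aug := g
    exact := by
      refine LinearMap.exact_iff.mpr ?_
      rw [LinearMap.range_comp, LinearMap.range_eq_top.mpr hh, Submodule.map_top,
        Submodule.range_subtype]
    surjective := hg }⟩

variable (ω : Type u) [AddCommGroup ω] [Module R ω]

/-- The map `d^ω = Hom_R(d, ω) : B^ω → A^ω` induced by `d : A → B`.

With `T = End_R(ω)` acting on the right of `ω` (so that products in `T` are opposite to composition),
right `T`-modules, i.e. left `T^op`-modules, are the left modules over `Module.End R ω`, whose
product is composition. It acts on `A^ω` by `(t • g) a = t (g a)`. -/
def dualMap {A B : Type u} [AddCommGroup A] [Module R A] [AddCommGroup B] [Module R B]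
    (d : A →ₗ[R] B) : (B →ₗ[R] ω) →ₗ[Module.End R ω] (A →ₗ[R] ω) where
  toFun g := g ∘ₗ d
  map_add' _ _ := rfl
  map_smul' _ _ := rfl

/-- The transpose `Tr_ω M` computed from the presentation `P₁ → P₀ → M → 0`: the cokernel of
`P₀^ω → P₁^ω`, as a `T^op`-module. -/
abbrev Transpose {M : Type u} [AddCommGroup M] [Module R M] (P : ProjPresentation R M) : Type u :=
  (P.P₁ →ₗ[R] ω) ⧸ LinearMap.range (dualMap ω P.d)

/-- `M` is `ω`-`n`-torsionfree, where `Tr_ω M` is computed from the presentation `P` of `M`: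
`Ext^i_{T^op}(Tr_ω M, ω) = 0` for `1 ≤ i ≤ n`. -/
def IsTorsionfree {M : Type u} [AddCommGroup M] [Module R M] (P : ProjPresentation R M)
    (n : ℕ) : Prop :=
  ∀ i : ℕ, 1 ≤ i → i ≤ n →
    Subsingleton (Abelian.Ext.{u} (ModuleCat.of (Module.End R ω) (Transpose ω P))
      (ModuleCat.of (Module.End R ω) ω) i)

end Transpose

section RingExtensions

variable {R S : Type u} [Ring R] [Ring S] (l : R →+* S)

/-- The ring extension `l : R → S` is Frobenius: `_R S` is finitely generated projective and there is
an isomorphism `φ : S ≅ Hom_R(_R S_S, _R R_R)` of `S`-`R`-bimodules, where `(s · f)(x) = f (x s)` and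
`(f · r)(x) = f(x) r`. -/
def IsFrobeniusExtension : Prop :=
  letI : Module R S := Module.compHom S l
  Module.Finite R S ∧ Module.Projective R S ∧
    ∃ φ : S ≃+ (S →ₗ[R] R),
      (∀ s t x : S, φ (s * t) x = φ t (x * s)) ∧
      (∀ (s : S) (r : R) (x : S), φ (s * l r) x = φ s x * r)

/-- `_R S_R` is centrally projective over `R`: it lies in `add (_R R_R)`, i.e. it is a direct summand,
as an `R`-`R`-bimodule, of a finite direct sum of copies of `_R R_R`. -/
def IsCentrallyProjective : Prop :=
  ∃ (k : ℕ) (i : S →+ (Fin k → R)) (p : (Fin k → R) →+ S),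
    (∀ (r : R) (s : S) (j : Fin k), i (l r * s) j = r * i s j) ∧
    (∀ (r : R) (s : S) (j : Fin k), i (s * l r) j = i s j * r) ∧
    (∀ (r : R) (v : Fin k → R), p (fun j => r * v j) = l r * p v) ∧
    (∀ (r : R) (v : Fin k → R), p (fun j => v j * r) = p v * l r) ∧
    ∀ s : S, p (i s) = s

variable (ω : Type u) [AddCommGroup ω] [Module R ω]

/-- The relations `(s l(r)) ⊗ w = s ⊗ (r w)` that cut `S ⊗_R ω` out of `S ⊗_ℤ ω`. The additive
subgroup generated by them is stable under left multiplication by `S`. -/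
def balancedRel : Submodule S (S ⊗[ℤ] ω) :=
  Submodule.span S {x | ∃ (s : S) (r : R) (w : ω), x = (s * l r) ⊗ₜ[ℤ] w - s ⊗ₜ[ℤ] (r • w)}

/-- The left `S`-module `S ⊗_R ω` for a homomorphism `l : R → S` of (noncommutative) rings. -/
abbrev BaseChange : Type u := (S ⊗[ℤ] ω) ⧸ balancedRel l ω

end RingExtensions

end RelTorsionfree

/-!
Write `ω' = S ⊗_R ω`, `T = End_R(ω)` and `T' = End_S(ω')`. The proof compares the two families of
Ext groups by one adjunction, used twice.

The Frobenius homomorphism `E : S → R` gives `θ : ω' → ω`, `s ⊗ w ↦ E(s) w`, which makes `ω'` the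
`S`-module coinduced from `ω`: composition with `θ` is a bijection `Hom_S(Y, ω') = Hom_R(Y, ω)`
for every `S`-module `Y` (`IsFrobeniusExtension.exists_isCoinduced`). In particular every `t ∈ T`
lifts uniquely to an endomorphism of `ω'`, which is a ring homomorphism `T → T'`
(`IsCoinduced.endHom`), and a presentation of `M` over `S`, restricted to `R`, computes the same
transpose (`IsCoinduced.nonempty_transpose_equiv`).

Central projectivity makes `ω'` a summand of some `ω^k` over `R`
(`IsCentrallyProjective.nonempty_addRetract`). Hence `T' = Hom_R(ω', ω)` is projective over `T`,
and `ω' → Hom_T(Hom_R(ω', ω), ω) = Hom_T(T', ω)` is bijective, because both hold for `ω` in place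
of `ω'`. So `ω'` is also coinduced from `ω` along `T → T'` (`IsCoinduced.endHom_isCoinduced`), and
Eckmann–Shapiro says that `Extⁱ_{T'}(Y, ω')` and `Extⁱ_T(Y, ω)` vanish together for every
`T'`-module `Y` (`IsCoinduced.subsingleton_ext_iff`). Applied to the transpose, this is the
theorem for the restricted presentation.

It remains to replace the restricted presentation by an arbitrary one over `R`. Transposes for two
presentations agree up to summands of finite sums of copies of `ω` (`subsingleton_ext_transpose`),
so it suffices that `Extⁱ_T(ω, ω) = 0` for `1 ≤ i ≤ n`. This is where `fadim ω ≥ n + 2` enters: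
the dual of the defining sequence is the beginning of a projective resolution of `ω` over `T`
(`FaithfulDimGE.subsingleton_ext`).
-/

namespace RelTorsionfree

/-! ### Vanishing of Ext: summands and dimension shifting -/

section ExtVanishing

open Abelian

variable {A : Type u} [Ring A]

/-- If `Extⁿ(Z, V) = 0`, then an endomorphism of `Y` that factors through `Z` acts as zero on
`Extⁿ(Y, V)`. -/
lemma mk₀_comp_eq_zero_of_factors {Y Z V : ModuleCat.{u} A} {n : ℕ}
    (hZ : Subsingleton (Ext.{u} Z V n)) (a : Y ⟶ Z) (b : Z ⟶ Y) (x : Ext.{u} Y V n) :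
    (Ext.mk₀ (a ≫ b)).comp x (zero_add n) = 0 := by
  rw [← Ext.mk₀_comp_mk₀_assoc, Subsingleton.elim ((Ext.mk₀ b).comp x (zero_add n)) 0,
    Ext.comp_zero]

lemma subsingleton_ext_of_add {Y Z W V : ModuleCat.{u} A} {n : ℕ}
    (hZ : Subsingleton (Ext.{u} Z V n)) (hW : Subsingleton (Ext.{u} W V n))
    (a : Y ⟶ Z) (b : Z ⟶ Y) (c : Y ⟶ W) (d : W ⟶ Y) (h : a ≫ b + c ≫ d = 𝟙 Y) :
    Subsingleton (Ext.{u} Y V n) := by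
  refine subsingleton_of_forall_eq 0 fun x ↦ ?_
  rw [← Ext.mk₀_id_comp x, ← h, Ext.mk₀_add, Ext.add_comp,
    mk₀_comp_eq_zero_of_factors hZ, mk₀_comp_eq_zero_of_factors hW, add_zero]

lemma subsingleton_ext_of_sum {Y Z V : ModuleCat.{u} A} {n : ℕ} {ι : Type*} [Fintype ι]
    (hZ : Subsingleton (Ext.{u} Z V n)) (a : ι → (Y ⟶ Z)) (b : ι → (Z ⟶ Y))
    (h : ∑ j, a j ≫ b j = 𝟙 Y) :
    Subsingleton (Ext.{u} Y V n) := by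
  refine subsingleton_of_forall_eq 0 fun x ↦ ?_
  rw [← Ext.mk₀_id_comp x, ← h, Ext.mk₀_sum, Ext.sum_comp]
  exact Finset.sum_eq_zero fun j _ ↦ mk₀_comp_eq_zero_of_factors hZ _ _ _

lemma subsingleton_ext_of_linearEquiv {Y Z : Type u} [AddCommGroup Y] [Module A Y]
    [AddCommGroup Z] [Module A Z] (e : Y ≃ₗ[A] Z) {V : ModuleCat.{u} A} {n : ℕ}
    (hZ : Subsingleton (Ext.{u} (ModuleCat.of A Z) V n)) :
    Subsingleton (Ext.{u} (ModuleCat.of A Y) V n) :=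
  subsingleton_ext_of_sum (ι := Unit) hZ (fun _ ↦ e.toModuleIso.hom) (fun _ ↦ e.toModuleIso.inv)
    (by rw [Fintype.sum_unique, Iso.hom_inv_id])

variable {K F Y V : Type u} [AddCommGroup K] [Module A K] [AddCommGroup F] [Module A F]
  [AddCommGroup Y] [Module A Y] [AddCommGroup V] [Module A V]
  {f : K →ₗ[A] F} {g : F →ₗ[A] Y}

lemma shortExact_of_linearMap (hf : Function.Injective f) (hfg : Function.Exact f g)
    (hg : Function.Surjective g) :
    (ShortComplex.mk (ModuleCat.ofHom f) (ModuleCat.ofHom g)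
      (by ext x; exact hfg.apply_apply_eq_zero x)).ShortExact where
  exact := (ShortComplex.ShortExact.moduleCat_exact_iff_function_exact _).mpr hfg
  mono_f := (ModuleCat.mono_iff_injective _).mpr hf
  epi_g := (ModuleCat.epi_iff_surjective _).mpr hg

/-- If `0 → K → F → Y → 0` is exact and `F` is projective, then `Ext¹(Y, V)` is the cokernel of
`Hom(F, V) → Hom(K, V)`; it vanishes when every map `K → V` extends to `F`. -/
lemma subsingleton_ext_one_iff [Module.Projective A F] (hf : Function.Injective f)
    (hfg : Function.Exact f g) (hg : Function.Surjective g) :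
    Subsingleton (Ext.{u} (ModuleCat.of A Y) (ModuleCat.of A V) 1) ↔
      ∀ h : K →ₗ[A] V, ∃ h' : F →ₗ[A] V, h' ∘ₗ f = h := by
  have hS := shortExact_of_linearMap hf hfg hg
  have : Projective (ModuleCat.of A F) := (IsProjective.iff_projective F).mp inferInstance
  constructor
  · intro _ h
    obtain ⟨x₂, hx₂⟩ := Ext.contravariant_sequence_exact₁ hS _ (Ext.mk₀ (ModuleCat.ofHom h))
      (add_zero 1) (Subsingleton.elim _ _)
    obtain ⟨h', rfl⟩ := (Ext.mk₀_bijective _ _).surjective x₂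
    rw [Ext.mk₀_comp_mk₀] at hx₂
    have := (Ext.mk₀_bijective _ _).injective hx₂
    exact ⟨h'.hom, congrArg ModuleCat.Hom.hom this⟩
  · intro H
    refine subsingleton_of_forall_eq 0 fun x ↦ ?_
    obtain ⟨x₁, rfl⟩ := Ext.contravariant_sequence_exact₃ hS _ x (Ext.eq_zero_of_projective _)
      (add_zero 1)
    obtain ⟨h, rfl⟩ := (Ext.mk₀_bijective _ _).surjective x₁
    obtain ⟨h', hh'⟩ := H h.hom
    have : h = ModuleCat.ofHom f ≫ ModuleCat.ofHom h' := by
      ext x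
      exact (LinearMap.congr_fun hh' x).symm
    rw [this, ← Ext.mk₀_comp_mk₀]
    exact hS.extClass_comp_assoc _

lemma subsingleton_ext_succ_iff [Module.Projective A F] (hf : Function.Injective f)
    (hfg : Function.Exact f g) (hg : Function.Surjective g) (j : ℕ) :
    Subsingleton (Ext.{u} (ModuleCat.of A Y) (ModuleCat.of A V) (j + 1 + 1)) ↔
      Subsingleton (Ext.{u} (ModuleCat.of A K) (ModuleCat.of A V) (j + 1)) := by
  have hS := shortExact_of_linearMap hf hfg hg
  have : Projective (ModuleCat.of A F) := (IsProjective.iff_projective F).mp inferInstance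
  constructor
  · intro _
    refine subsingleton_of_forall_eq 0 fun x ↦ ?_
    obtain ⟨x₂, rfl⟩ := Ext.contravariant_sequence_exact₁ hS _ x (add_comm 1 (j + 1))
      (Subsingleton.elim _ _)
    rw [Ext.eq_zero_of_projective x₂, Ext.comp_zero]
  · intro _
    refine subsingleton_of_forall_eq 0 fun x ↦ ?_
    obtain ⟨x₁, rfl⟩ := Ext.contravariant_sequence_exact₃ hS _ x (Ext.eq_zero_of_projective _)
      (add_comm 1 (j + 1))
    rw [Subsingleton.elim x₁ 0, Ext.comp_zero]

end ExtVanishing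

/-! ### Coinduced modules and the Eckmann–Shapiro lemma -/

section Coinduction

open Abelian

/-- `θ : V → W` exhibits the `B`-module `V` as coinduced from the `A`-module `W` along the ring
homomorphism `ρ : A → B`: it is `A`-linear and, for every `B`-module `Y`, composition with `θ` is a
bijection from `Hom_B(Y, V)` to `Hom_A(Y, W)`. Modules over `B` are viewed as `A`-modules through
`ρ` without naming an instance, so an `A`-linear map is an additive map satisfying an equation. -/
structure IsCoinduced {A B : Type u} [Ring A] [Ring B] (ρ : A →+* B) {V W : Type u}
    [AddCommGroup V] [Module B V] [AddCommGroup W] [Module A W] (θ : V →+ W) : Prop where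
  map_smul : ∀ a v, θ (ρ a • v) = a • θ v
  existsUnique : ∀ (Y : Type u) [AddCommGroup Y] [Module B Y] (h : Y →+ W),
    (∀ a y, h (ρ a • y) = a • h y) → ∃! g : Y →ₗ[B] V, ∀ y, θ (g y) = h y

namespace IsCoinduced

variable {A B : Type u} [Ring A] [Ring B] {ρ : A →+* B} {V W : Type u}
    [AddCommGroup V] [Module B V] [AddCommGroup W] [Module A W] {θ : V →+ W}

/-- It suffices to test the universal property on `Y = B`, that is, to know that `V` is identified
with `Hom_A(B, W)`. -/
lemma of_existsUnique (hθ : ∀ a v, θ (ρ a • v) = a • θ v)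
    (H : ∀ h : B →+ W, (∀ a b, h (ρ a * b) = a • h b) → ∃! v : V, ∀ b : B, θ (b • v) = h b) :
    IsCoinduced ρ θ where
  map_smul := hθ
  existsUnique Y _ _ h hh := by
    have key : ∀ y : Y, ∃! v : V, ∀ b : B, θ (b • v) = h (b • y) := fun y ↦
      H (h.comp (AddMonoidHom.flip (smulAddHom B Y) y)) fun a b ↦ by
        simp [mul_smul, hh]
    choose g hg hguniq using key
    refine ⟨
      { toFun := g
        map_add' := fun y z ↦ (hguniq _ _ fun b ↦ by simp [smul_add, hg]).symm
        map_smul' := fun c y ↦ (hguniq _ _ fun b ↦ by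
          simp only [RingHom.id_apply, ← mul_smul, hg]).symm }, fun y ↦ by simpa using hg y 1, ?_⟩
    intro g' hg'
    ext y
    exact hguniq _ _ fun b ↦ by rw [← g'.map_smul, hg']

lemma hom_ext (hc : IsCoinduced ρ θ) {Y : Type u} [AddCommGroup Y] [Module B Y]
    {g g' : Y →ₗ[B] V} (h : ∀ y, θ (g y) = θ (g' y)) : g = g' :=
  (hc.existsUnique Y (θ.comp g'.toAddMonoidHom) fun a y ↦ by simp [hc.map_smul]).unique h
    fun _ ↦ rfl

lemma exists_lift (hc : IsCoinduced ρ θ) {Y : Type u} [AddCommGroup Y] [Module B Y] [Module A Y]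
    (hY : ∀ (a : A) (y : Y), a • y = ρ a • y) (h : Y →ₗ[A] W) :
    ∃ g : Y →ₗ[B] V, ∀ y, θ (g y) = h y :=
  (hc.existsUnique Y h.toAddMonoidHom fun a y ↦ by simp [← hY]).exists

/-- Composition with `θ`, as a map from `B`-linear to `A`-linear maps. -/
def comp (hc : IsCoinduced ρ θ) {Y : Type u} [AddCommGroup Y] [Module B Y] [Module A Y]
    (hY : ∀ (a : A) (y : Y), a • y = ρ a • y) (g : Y →ₗ[B] V) : Y →ₗ[A] W where
  toFun y := θ (g y)
  map_add' := by simp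
  map_smul' a y := by simp [hY, hc.map_smul]

/-- If `B` is projective over `A`, then every `B`-module `Y` has a presentation `0 → K → F → Y → 0`
over `B` whose middle term is projective both over `B` and over `A`. -/
lemma exists_presentation (ρ : A →+* B)
    (hB : letI : Module A B := Module.compHom B ρ; Module.Projective A B)
    (Y : Type u) [AddCommGroup Y] [Module B Y] :
    ∃ (K F : Type u) (_ : AddCommGroup K) (_ : AddCommGroup F) (_ : Module A K) (_ : Module B K)
      (_ : Module A F) (_ : Module B F) (i : K →ₗ[B] F) (g : F →ₗ[B] Y),
      (∀ (a : A) (y : K), a • y = ρ a • y) ∧ (∀ (a : A) (y : F), a • y = ρ a • y) ∧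
      Module.Projective A F ∧ Module.Projective B F ∧
      Function.Injective i ∧ Function.Exact i g ∧ Function.Surjective g := by
  let _ : Module A B := Module.compHom B ρ
  let g : (Y →₀ B) →ₗ[B] Y := Finsupp.linearCombination B id
  refine ⟨LinearMap.ker g, Y →₀ B, inferInstance, inferInstance, Module.compHom _ ρ,
    inferInstance, inferInstance, inferInstance, (LinearMap.ker g).subtype, g, fun _ _ ↦ rfl,
    fun _ _ ↦ rfl, ?_, inferInstance, Subtype.val_injective, LinearMap.exact_subtype_ker_map g,
    Finsupp.linearCombination_id_surjective B Y⟩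
  classical exact Module.Projective.of_equiv (finsuppLequivDFinsupp A).symm

/-- Eckmann–Shapiro: if `B` is projective over `A` and `V` is coinduced from `W`, then the
groups `Extⁱ_B(Y, V)` and `Extⁱ_A(Y, W)` vanish together. Both are computed by shifting along a
presentation of `Y` by a free `B`-module, which remains projective over `A`. -/
theorem subsingleton_ext_iff (hc : IsCoinduced ρ θ)
    (hB : letI : Module A B := Module.compHom B ρ; Module.Projective A B) (j : ℕ)
    (Y : Type u) [AddCommGroup Y] [Module A Y] [Module B Y]
    (hY : ∀ (a : A) (y : Y), a • y = ρ a • y) :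
    Subsingleton (Ext.{u} (ModuleCat.of B Y) (ModuleCat.of B V) (j + 1)) ↔
      Subsingleton (Ext.{u} (ModuleCat.of A Y) (ModuleCat.of A W) (j + 1)) := by
  induction j generalizing Y with
  | zero =>
    obtain ⟨K, F, _, _, _, _, _, _, i, g, hK, hF, _, _, hi, hig, hg⟩ := exists_presentation ρ hB Y
    let gA : F →ₗ[A] Y :=
      { toFun := g, map_add' := map_add g, map_smul' := fun a y ↦ by simp [hF, hY] }
    let iA : K →ₗ[A] F :=
      { toFun := i, map_add' := map_add i, map_smul' := fun a y ↦ by simp [hF, hK] }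
    have higA : Function.Exact iA gA := hig
    rw [subsingleton_ext_one_iff hi hig hg,
      subsingleton_ext_one_iff (f := iA) (g := gA) hi higA hg]
    constructor
    · intro H h
      obtain ⟨k, hk⟩ := hc.exists_lift hK h
      obtain ⟨k', rfl⟩ := H k
      exact ⟨hc.comp hF k', LinearMap.ext hk⟩
    · intro H k
      obtain ⟨h', hh'⟩ := H (hc.comp hK k)
      obtain ⟨k', hk'⟩ := hc.exists_lift hF h'
      refine ⟨k', hc.hom_ext fun y ↦ ?_⟩
      exact (hk' _).trans (LinearMap.congr_fun hh' y)
  | succ j ih =>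
    obtain ⟨K, F, _, _, _, _, _, _, i, g, hK, hF, _, _, hi, hig, hg⟩ := exists_presentation ρ hB Y
    let gA : F →ₗ[A] Y :=
      { toFun := g, map_add' := map_add g, map_smul' := fun a y ↦ by simp [hF, hY] }
    let iA : K →ₗ[A] F :=
      { toFun := i, map_add' := map_add i, map_smul' := fun a y ↦ by simp [hF, hK] }
    have higA : Function.Exact iA gA := hig
    rw [subsingleton_ext_succ_iff hi hig hg,
      subsingleton_ext_succ_iff (f := iA) (g := gA) hi higA hg]
    exact ih K hK

end IsCoinduced

end Coinduction

/-! ### Passing from a coinduced module to endomorphism rings -/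

section EndomorphismRings

namespace IsCoinduced

variable {A B : Type u} [Ring A] [Ring B] {ρ : A →+* B} {V W : Type u}
    [AddCommGroup V] [Module B V] [AddCommGroup W] [Module A W] {θ : V →+ W}

lemma exists_end (hc : IsCoinduced ρ θ) (t : Module.End A W) :
    ∃ g : Module.End B V, ∀ v, θ (g v) = t (θ v) :=
  (hc.existsUnique V (t.toAddMonoidHom.comp θ) fun a v ↦ by simp [hc.map_smul]).exists

/-- The unique `B`-linear endomorphism of `V` lying over an endomorphism of `W`. -/
noncomputable def endLift (hc : IsCoinduced ρ θ) (t : Module.End A W) : Module.End B V :=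
  (hc.exists_end t).choose

@[simp]
lemma apply_endLift (hc : IsCoinduced ρ θ) (t : Module.End A W) (v : V) :
    θ (hc.endLift t v) = t (θ v) :=
  (hc.exists_end t).choose_spec v

/-- `endLift` as a ring homomorphism `End_A(W) → End_B(V)`. -/
noncomputable def endHom (hc : IsCoinduced ρ θ) : Module.End A W →+* Module.End B V where
  toFun := hc.endLift
  map_one' := hc.hom_ext fun v ↦ by simp
  map_mul' t t' := hc.hom_ext fun v ↦ by simp
  map_zero' := hc.hom_ext fun v ↦ by simp
  map_add' t t' := hc.hom_ext fun v ↦ by simp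

@[simp]
lemma apply_endHom (hc : IsCoinduced ρ θ) (t : Module.End A W) (v : V) :
    θ (hc.endHom t v) = t (θ v) :=
  hc.apply_endLift t v

/-- The data expressing that `V`, viewed as an `A`-module through `ρ`, is a direct summand of a
finite direct sum of copies of `W`: maps `fst j : V → W` and `snd j : W → V` for `j < k` with
`∑ snd j ∘ fst j = 1`. Linearity over `A` is stated by equations, so that `V` needs no `A`-module
instance. -/
structure AddRetract (ρ : A →+* B) (V W : Type u) [AddCommGroup V] [Module B V] [AddCommGroup W]
    [Module A W] where
  k : ℕ
  fst : Fin k → V →+ W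
  snd : Fin k → W →+ V
  fst_smul : ∀ j a v, fst j (ρ a • v) = a • fst j v
  snd_smul : ∀ j a w, snd j (a • w) = ρ a • snd j w
  sum_snd_fst : ∀ v, ∑ j, snd j (fst j v) = v

lemma AddRetract.exists_lift (hc : IsCoinduced ρ θ) (r : AddRetract ρ V W) (j : Fin r.k) :
    ∃ α : Module.End B V, ∀ v, θ (α v) = r.fst j v :=
  (hc.existsUnique V (r.fst j) (r.fst_smul j)).exists

/-- The composite `W → V → V → W` of the `j`-th inclusion, an endomorphism `t` of `V`, and `θ`. -/
def AddRetract.component (hc : IsCoinduced ρ θ) (r : AddRetract ρ V W) (j : Fin r.k)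
    (t : Module.End B V) : Module.End A W where
  toFun w := θ (t (r.snd j w))
  map_add' := by simp
  map_smul' a w := by simp [r.snd_smul, hc.map_smul]

/-- As `End_B(V) = Hom_A(V, W)`, the lifts `α j` of the projections generate `End_B(V)` over
`End_A(W)`, with the maps `component j` as coordinates. -/
lemma AddRetract.sum_component (hc : IsCoinduced ρ θ) (r : AddRetract ρ V W)
    (α : Fin r.k → Module.End B V) (hα : ∀ j v, θ (α j v) = r.fst j v) (t : Module.End B V) :
    ∑ j, hc.endHom (r.component hc j t) * α j = t := by
  refine hc.hom_ext fun v ↦ ?_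
  simp only [LinearMap.sum_apply, map_sum, Module.End.mul_apply, apply_endHom, hα,
    AddRetract.component, LinearMap.coe_mk, AddHom.coe_mk]
  rw [← map_sum, ← map_sum, r.sum_snd_fst]

/-- If `V` is in addition a summand of `W^k` over `A`, then coinduction passes to the endomorphism
rings. Indeed `End_B(V) = Hom_A(V, W)`, so the claim is that `V → Hom(Hom_A(V, W), W)` is bijective,
where the outer `Hom` is over `End_A(W)`; that holds for `W` and is inherited by summands of
`W^k`. -/
theorem endHom_isCoinduced (hc : IsCoinduced ρ θ) (r : AddRetract ρ V W) :
    IsCoinduced hc.endHom θ := by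
  choose α hα using r.exists_lift hc
  refine of_existsUnique (fun t v ↦ hc.apply_endHom t v) fun h hh ↦
    ⟨∑ j, r.snd j (h (α j)), fun t ↦ ?_, fun v hv ↦ ?_⟩
  · conv_rhs => rw [← r.sum_component hc α hα t]
    simp only [map_sum, hh, Module.End.smul_def]
    rfl
  · conv_lhs => rw [← r.sum_snd_fst v]
    exact Finset.sum_congr rfl fun j _ ↦ by rw [← hv (α j), Module.End.smul_def, hα]

/-- Under the same hypothesis `End_B(V) = Hom_A(V, W)` is projective over `End_A(W)`, as it is a
summand of `Hom_A(W^k, W)`. -/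
theorem projective_end (hc : IsCoinduced ρ θ) (r : AddRetract ρ V W) :
    letI : Module (Module.End A W) (Module.End B V) := Module.compHom _ hc.endHom
    Module.Projective (Module.End A W) (Module.End B V) := by
  let _ : Module (Module.End A W) (Module.End B V) := Module.compHom _ hc.endHom
  have hsmul : ∀ (t : Module.End A W) (t' : Module.End B V), t • t' = hc.endHom t * t' :=
    fun _ _ ↦ rfl
  choose α hα using r.exists_lift hc
  let i : Module.End B V →ₗ[Module.End A W] (Fin r.k → Module.End A W) :=
    { toFun := fun t j ↦ r.component hc j t
      map_add' := fun t t' ↦ by ext; simp [AddRetract.component]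
      map_smul' := fun t t' ↦ by ext; simp [AddRetract.component, hsmul] }
  let p : (Fin r.k → Module.End A W) →ₗ[Module.End A W] Module.End B V :=
    { toFun := fun t ↦ ∑ j, hc.endHom (t j) * α j
      map_add' := fun t t' ↦ by simp [add_mul, Finset.sum_add_distrib]
      map_smul' := fun t t' ↦ by simp [hsmul, Finset.mul_sum, mul_assoc] }
  exact Module.Projective.of_split i p (LinearMap.ext (r.sum_component hc α hα))

end IsCoinduced

end EndomorphismRings

/-! ### Base change along Frobenius and centrally projective extensions -/

section FrobeniusExtensions

variable {R S : Type u} [Ring R] [Ring S] {l : R →+* S} {ω : Type u} [AddCommGroup ω] [Module R ω]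

namespace BaseChange

/-- The elementary tensor `s ⊗ w` in `S ⊗_R ω`. -/
def tmul (l : R →+* S) (s : S) (w : ω) : BaseChange l ω :=
  (balancedRel l ω).mkQ (s ⊗ₜ[ℤ] w)

lemma smul_tmul (s t : S) (w : ω) : s • tmul l t w = tmul l (s * t) w := rfl

lemma tmul_add (s : S) (w w' : ω) : tmul l s (w + w') = tmul l s w + tmul l s w' := by
  simp [tmul, TensorProduct.tmul_add]

lemma add_tmul (s t : S) (w : ω) : tmul l (s + t) w = tmul l s w + tmul l t w := by
  simp [tmul, TensorProduct.add_tmul]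

lemma mul_tmul (s : S) (r : R) (w : ω) : tmul l (s * l r) w = tmul l s (r • w) := by
  rw [← sub_eq_zero, tmul, tmul, ← map_sub, Submodule.mkQ_apply, Submodule.Quotient.mk_eq_zero]
  exact Submodule.subset_span ⟨s, r, w, rfl⟩

/-- The map `w ↦ s ⊗ w`. -/
def tmulRight (l : R →+* S) (s : S) : ω →+ BaseChange l ω :=
  AddMonoidHom.mk' (tmul l s) (tmul_add s)

@[simp]
lemma tmulRight_apply (s : S) (w : ω) : tmulRight l s w = tmul l s w := rfl

lemma sum_tmul {ι : Type*} (t : Finset ι) (s : ι → S) (w : ω) :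
    tmul l (∑ j ∈ t, s j) w = ∑ j ∈ t, tmul l (s j) w :=
  map_sum (AddMonoidHom.mk' (fun s ↦ tmul l s w) fun s t ↦ add_tmul s t w) _ _

variable {G : Type*} [AddCommGroup G]

/-- Additive maps out of `S ⊗_R ω` are determined by their values on elementary tensors. -/
lemma addHom_ext {f g : BaseChange l ω →+ G} (h : ∀ s w, f (tmul l s w) = g (tmul l s w)) :
    f = g := by
  ext x
  obtain ⟨x, rfl⟩ := Submodule.mkQ_surjective _ x
  induction x with
  | zero => simp
  | tmul s w => exact h s w
  | add x y hx hy => simp only [map_add, hx, hy]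

/-- A balanced biadditive map kills the `S`-span of the defining relations, because the relations
themselves are stable under left multiplication by `S`. -/
lemma balancedRel_le_ker (f : S →+ ω →+ G) (hf : ∀ s r w, f (s * l r) w = f s (r • w)) :
    (balancedRel l ω).restrictScalars ℤ ≤
      LinearMap.ker (TensorProduct.liftAddHom f
        fun z s w ↦ by rw [map_zsmul, map_zsmul]; rfl).toIntLinearMap := by
  have key : ∀ x ∈ balancedRel l ω, ∀ s : S,
      TensorProduct.liftAddHom f (fun z s w ↦ by rw [map_zsmul, map_zsmul]; rfl) (s • x) = 0 := by
    intro x hx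
    induction hx using Submodule.span_induction with
    | mem x hx =>
      obtain ⟨t, r, w, rfl⟩ := hx
      intro s
      simp [smul_sub, TensorProduct.smul_tmul', ← mul_assoc, hf]
    | zero => simp
    | add x y _ _ hx hy => intro s; rw [smul_add, map_add, hx, hy, add_zero]
    | smul t x _ hx => intro s; rw [← mul_smul, hx]
  intro x hx
  simpa using! key x hx 1

/-- The additive map out of `S ⊗_R ω` induced by a balanced biadditive map. -/
def lift (f : S →+ ω →+ G) (hf : ∀ s r w, f (s * l r) w = f s (r • w)) : BaseChange l ω →+ G :=
  ((((balancedRel l ω).restrictScalars ℤ).liftQ _ (balancedRel_le_ker f hf)).comp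
    (Submodule.Quotient.restrictScalarsEquiv ℤ (balancedRel l ω)).symm.toLinearMap).toAddMonoidHom

end BaseChange

open BaseChange in
/-- For a Frobenius extension, `S ⊗_R ω` is coinduced from `ω`. With `E = φ 1 : S → R` the Frobenius
homomorphism, `θ (s ⊗ w) = E s • w`; and a dual basis of `_R S` gives elements `x_j`, `y_j` of `S`
with `∑ E (s y_j) x_j = s = ∑ y_j E (x_j s)`, so that `v = ∑ y_j ⊗ θ (x_j v)` for all `v`. -/
theorem IsFrobeniusExtension.exists_isCoinduced (hl : IsFrobeniusExtension l) (ω : Type u)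
    [AddCommGroup ω] [Module R ω] : ∃ θ : BaseChange l ω →+ ω, IsCoinduced l θ := by
  let _ : Module R S := Module.compHom S l
  have hRS : ∀ (r : R) (s : S), r • s = l r * s := fun _ _ ↦ rfl
  obtain ⟨_, _, φ, hφ₁, hφ₂⟩ := hl
  obtain ⟨k, p, i, -, -, hpi⟩ := Module.Finite.exists_comp_eq_id_of_projective R S
  let E : S →ₗ[R] R := φ 1
  have hE : ∀ s x, φ s x = E (x * s) := fun s x ↦ by rw [← hφ₁, mul_one]
  have hEr : ∀ r x, E (x * l r) = E x * r := fun r x ↦ by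
    rw [← hE, ← hφ₂, one_mul]
  have hEl : ∀ r x, E (l r * x) = r * E x := fun r x ↦ by
    rw [← hRS, map_smul, smul_eq_mul]
  let x : Fin k → S := fun j ↦ p (Pi.single j 1)
  let y : Fin k → S := fun j ↦ φ.symm (LinearMap.proj j ∘ₗ i)
  have hxy : ∀ s, ∑ j, l (E (s * y j)) * x j = s := fun s ↦ by
    have hy : ∀ j, E (s * y j) = i s j := fun j ↦ by rw [← hE]; simp [y]
    simp only [hy, x, ← hRS, ← map_smul, ← map_sum]
    have := LinearMap.congr_fun hpi s
    simp only [LinearMap.comp_apply, LinearMap.id_apply] at this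
    conv_rhs => rw [← this]
    congr 1
    ext j
    simp [Finset.sum_apply, Pi.single_apply]
  have hyx : ∀ s, ∑ j, y j * l (E (x j * s)) = s := fun s ↦ by
    refine φ.injective (LinearMap.ext fun t ↦ ?_)
    refine (hE _ t).trans (Eq.trans ?_ (hE s t).symm)
    rw [Finset.mul_sum, map_sum]
    conv_rhs => rw [← hxy t, Finset.sum_mul, map_sum]
    simp only [mul_assoc, hEl]
    simp only [← mul_assoc, hEr]
  let θ : BaseChange l ω →+ ω := lift ((smulAddHom R ω).comp E.toAddMonoidHom) fun s r w ↦ by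
    simp [hEr, mul_smul]
  have hθ : ∀ s w, θ (tmul l s w) = E s • w := fun s w ↦ rfl
  have hbasis : ∀ v : BaseChange l ω, ∑ j, tmul l (y j) (θ (x j • v)) = v := by
    let f : BaseChange l ω →+ BaseChange l ω :=
      ∑ j, (tmulRight l (y j)).comp (θ.comp (DistribSMul.toAddMonoidHom _ (x j)))
    have hf : f = AddMonoidHom.id _ := addHom_ext fun s w ↦ by
      simp [f, smul_tmul, hθ, ← mul_tmul, ← sum_tmul, hyx]
    intro v
    simpa [f] using DFunLike.congr_fun hf v
  refine ⟨θ, IsCoinduced.of_existsUnique (fun r v ↦ ?_) fun h hh ↦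
    ⟨∑ j, tmul l (y j) (h (x j)), fun s ↦ ?_, fun v hv ↦ ?_⟩⟩
  · have : θ.comp (DistribSMul.toAddMonoidHom _ (l r)) =
        (DistribSMul.toAddMonoidHom _ r).comp θ :=
      addHom_ext fun s w ↦ by simp [smul_tmul, hθ, hEl, mul_smul]
    exact DFunLike.congr_fun this v
  · simp only [Finset.smul_sum, smul_tmul, map_sum, hθ, ← hh]
    rw [← map_sum, hxy]
  · simp only [← hv, hbasis]

open BaseChange in
/-- If `_R S_R` is a summand of `R^k`, then `S ⊗_R ω` is a summand of `ω^k` over `R`. -/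
theorem IsCentrallyProjective.nonempty_addRetract (hl : IsCentrallyProjective l) (ω : Type u)
    [AddCommGroup ω] [Module R ω] : Nonempty (IsCoinduced.AddRetract l (BaseChange l ω) ω) := by
  obtain ⟨k, i, p, hil, hir, hpl, hpr, hpi⟩ := hl
  -- `c j` is the image of a basis vector of `R^k`, which commutes with `R`.
  let c : Fin k → S := fun j ↦ p (Pi.single j 1)
  have hc : ∀ r j, l r * c j = c j * l r := fun r j ↦ by
    rw [← hpl, ← hpr]
    congr 1
    ext m
    by_cases h : m = j
    · subst h; simp
    · simp [h]
  have hci : ∀ s, ∑ j, c j * l (i s j) = s := fun s ↦ by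
    conv_rhs => rw [← hpi s]
    simp only [c, ← hpr, ← map_sum]
    congr 1
    ext j
    simp [Finset.sum_apply, Pi.single_apply]
  let a : Fin k → BaseChange l ω →+ ω := fun j ↦
    lift ((smulAddHom R ω).comp ((Pi.evalAddMonoidHom _ j).comp i)) fun s r w ↦ by
      simp [hir, mul_smul]
  have ha : ∀ j s w, a j (tmul l s w) = i s j • w := fun j s w ↦ rfl
  refine ⟨⟨k, a, fun j ↦ tmulRight l (c j), fun j r v ↦ ?_, fun j r w ↦ ?_, fun v ↦ ?_⟩⟩
  · have : (a j).comp (DistribSMul.toAddMonoidHom _ (l r)) =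
        (DistribSMul.toAddMonoidHom _ r).comp (a j) :=
      addHom_ext fun s w ↦ by simp [smul_tmul, ha, hil, mul_smul]
    exact DFunLike.congr_fun this v
  · simp [smul_tmul, hc, mul_tmul]
  · have : ∑ j, (tmulRight l (c j)).comp (a j) = AddMonoidHom.id (BaseChange l ω) :=
      addHom_ext fun s w ↦ by
        simp [ha, ← mul_tmul, ← sum_tmul, hci]
    simpa using DFunLike.congr_fun this v

end FrobeniusExtensions

/-! ### Duals with respect to `ω` -/

section Duals

open Abelian

variable {R : Type u} [Ring R] (ω : Type u) [AddCommGroup ω] [Module R ω]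

/-- Evaluation at `x`, as an `End_R(ω)`-linear map `A^ω → ω`. -/
def evalDual {A : Type u} [AddCommGroup A] [Module R A] (x : A) :
    (A →ₗ[R] ω) →ₗ[Module.End R ω] ω where
  toFun φ := φ x
  map_add' _ _ := rfl
  map_smul' _ _ := rfl

@[simp]
lemma evalDual_apply {A : Type u} [AddCommGroup A] [Module R A] (x : A) (φ : A →ₗ[R] ω) :
    evalDual ω x φ = φ x := rfl

@[simp]
lemma dualMap_apply {A B : Type u} [AddCommGroup A] [Module R A] [AddCommGroup B] [Module R B]
    (d : A →ₗ[R] B) (φ : B →ₗ[R] ω) : dualMap ω d φ = φ ∘ₗ d := rfl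

/-- The `End_R(ω)`-linear map `ω → A^ω`, `w ↦ f(-) w`, attached to a functional `f : A → R`. -/
def smulDual {A : Type u} [AddCommGroup A] [Module R A] (f : A →ₗ[R] R) :
    ω →ₗ[Module.End R ω] (A →ₗ[R] ω) where
  toFun w := f.smulRight w
  map_add' w w' := by ext; simp
  map_smul' t w := by ext; simp

@[simp]
lemma smulDual_apply {A : Type u} [AddCommGroup A] [Module R A] (f : A →ₗ[R] R) (w : ω) (x : A) :
    smulDual ω f w x = f x • w := rfl

/-- The dual `P^ω` of a finitely generated projective module is a summand of some `ω^k`. -/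
lemma subsingleton_ext_dual_of_projective (P : Type u) [AddCommGroup P] [Module R P]
    [Module.Finite R P] [Module.Projective R P] {V : ModuleCat.{u} (Module.End R ω)} {n : ℕ}
    (h : Subsingleton (Ext.{u} (ModuleCat.of (Module.End R ω) ω) V n)) :
    Subsingleton (Ext.{u} (ModuleCat.of (Module.End R ω) (P →ₗ[R] ω)) V n) := by
  obtain ⟨k, p, i, -, -, hpi⟩ := Module.Finite.exists_comp_eq_id_of_projective R P
  refine subsingleton_ext_of_sum h
    (fun j ↦ ModuleCat.ofHom (evalDual ω (p (Pi.single j 1))))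
    (fun j ↦ ModuleCat.ofHom (smulDual ω (LinearMap.proj j ∘ₗ i))) ?_
  refine ModuleCat.hom_ext (LinearMap.ext fun (φ : P →ₗ[R] ω) ↦ ?_)
  rw [ModuleCat.hom_sum, LinearMap.sum_apply]
  change ∑ j, smulDual ω (LinearMap.proj j ∘ₗ i) (evalDual ω (p (Pi.single j 1)) φ) = φ
  ext x
  have hx : x = ∑ j, i x j • p (Pi.single j 1) := by
    conv_lhs => rw [← LinearMap.id_apply (R := R) x, ← hpi, LinearMap.comp_apply]
    simp only [← map_smul, ← map_sum]
    congr 1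
    ext j
    simp [Finset.sum_apply, Pi.single_apply]
  conv_rhs => rw [hx]
  simp [LinearMap.sum_apply]

end Duals

/-! ### Dependence of the transpose on the presentation -/

section PresentationIndependence

open Abelian

variable {R : Type u} [Ring R]

lemma exists_lift_of_exact {P A B C : Type u} [AddCommGroup P] [Module R P] [AddCommGroup A]
    [Module R A] [AddCommGroup B] [Module R B] [AddCommGroup C] [Module R C]
    [Module.Projective R P] {d : A →ₗ[R] B} {e : B →ₗ[R] C} (hde : Function.Exact d e)
    (g : P →ₗ[R] B) (hg : e ∘ₗ g = 0) : ∃ g' : P →ₗ[R] A, d ∘ₗ g' = g := by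
  obtain ⟨g', hg'⟩ := Module.projective_lifting_property d.rangeRestrict
    (g.codRestrict (LinearMap.range d) fun x ↦ (hde _).mp (LinearMap.congr_fun hg x))
    d.surjective_rangeRestrict
  exact ⟨g', LinearMap.ext fun x ↦ congrArg Subtype.val (LinearMap.congr_fun hg' x)⟩

variable {M : Type u} [AddCommGroup M] [Module R M]

/-- The identity of `M` lifts to a morphism between any two presentations. -/
lemma ProjPresentation.exists_hom (P P' : ProjPresentation R M) :
    ∃ (f₁ : P.P₁ →ₗ[R] P'.P₁) (f₀ : P.P₀ →ₗ[R] P'.P₀),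
      P'.d ∘ₗ f₁ = f₀ ∘ₗ P.d ∧ P'.aug ∘ₗ f₀ = P.aug := by
  have := P.projective₀
  have := P.projective₁
  obtain ⟨f₀, hf₀⟩ := Module.projective_lifting_property P'.aug P.aug P'.surjective
  obtain ⟨f₁, hf₁⟩ := exists_lift_of_exact P'.exact (f₀ ∘ₗ P.d) (by
    rw [← LinearMap.comp_assoc, hf₀]
    exact P.exact.linearMap_comp_eq_zero)
  exact ⟨f₁, f₀, hf₁, hf₀⟩

variable (ω : Type u) [AddCommGroup ω] [Module R ω]

/-- The map of transposes induced by a morphism of presentations. -/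
def Transpose.map {P P' : ProjPresentation R M} (f₁ : P.P₁ →ₗ[R] P'.P₁) (f₀ : P.P₀ →ₗ[R] P'.P₀)
    (h : P'.d ∘ₗ f₁ = f₀ ∘ₗ P.d) : Transpose ω P' →ₗ[Module.End R ω] Transpose ω P :=
  Submodule.mapQ _ _ (dualMap ω f₁) (by
    rintro _ ⟨ψ, rfl⟩
    exact ⟨ψ ∘ₗ f₀, by simp [LinearMap.comp_assoc, h]⟩)

/-- Two transposes of `M` agree up to summands `P^ω`. If `f : P → P'` and `g : P' → P` lift `id_M`,
then `g₁ f₁ - 1 = h d + e` with `d e = 0`; the summand `h d` induces zero on the transpose and `e`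
induces a map that factors through `P₁^ω`. Hence the identity of the transpose of `P` is a sum of a
map through the transpose of `P'` and a map through `P₁^ω`. -/
lemma subsingleton_ext_transpose {V : ModuleCat.{u} (Module.End R ω)} {n : ℕ}
    (hω : Subsingleton (Ext.{u} (ModuleCat.of (Module.End R ω) ω) V n))
    (P P' : ProjPresentation R M)
    (hP' : Subsingleton (Ext.{u} (ModuleCat.of (Module.End R ω) (Transpose ω P')) V n)) :
    Subsingleton (Ext.{u} (ModuleCat.of (Module.End R ω) (Transpose ω P)) V n) := by
  have := P.projective₀
  have := P.projective₁
  have := P.finite₁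
  obtain ⟨f₁, f₀, hf, hf₀⟩ := P.exists_hom P'
  obtain ⟨g₁, g₀, hg, hg₀⟩ := P'.exists_hom P
  obtain ⟨h, hh⟩ := exists_lift_of_exact P.exact (g₀ ∘ₗ f₀ - LinearMap.id) (by
    rw [LinearMap.comp_sub, ← LinearMap.comp_assoc, hg₀, hf₀, LinearMap.comp_id, sub_self])
  let e : P.P₁ →ₗ[R] P.P₁ := g₁ ∘ₗ f₁ - LinearMap.id - h ∘ₗ P.d
  have he : P.d ∘ₗ e = 0 := by
    simp only [e, LinearMap.comp_sub]
    rw [← LinearMap.comp_assoc, hg, LinearMap.comp_assoc, hf, ← LinearMap.comp_assoc,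
      ← LinearMap.comp_assoc, hh, LinearMap.sub_comp, LinearMap.id_comp, LinearMap.comp_id,
      sub_self]
  let c : Transpose ω P →ₗ[Module.End R ω] (P.P₁ →ₗ[R] ω) :=
    Submodule.liftQ _ (-dualMap ω e) (by
      rintro _ ⟨ψ, rfl⟩
      simp [LinearMap.comp_assoc, he])
  refine subsingleton_ext_of_add hP' (subsingleton_ext_dual_of_projective ω P.P₁ hω)
    (ModuleCat.ofHom (Transpose.map ω g₁ g₀ hg)) (ModuleCat.ofHom (Transpose.map ω f₁ f₀ hf))
    (ModuleCat.ofHom c) (ModuleCat.ofHom (Submodule.mkQ _)) ?_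
  ext φ
  refine (Submodule.Quotient.eq _).mpr ⟨φ ∘ₗ h, ?_⟩
  change (φ ∘ₗ h) ∘ₗ P.d = (φ ∘ₗ g₁) ∘ₗ f₁ + -(φ ∘ₗ e) - φ
  ext x
  simp only [e, LinearMap.comp_apply, LinearMap.add_apply, LinearMap.sub_apply,
    LinearMap.neg_apply, LinearMap.id_apply, map_sub]
  abel

/-- Whether `M` is `ω`-`n`-torsionfree does not depend on the presentation as soon as
`Extⁱ(ω, ω) = 0` over `End_R(ω)` for `1 ≤ i ≤ n`. -/
theorem isTorsionfree_congr {n : ℕ}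
    (hω : ∀ i : ℕ, 1 ≤ i → i ≤ n → Subsingleton (Ext.{u} (ModuleCat.of (Module.End R ω) ω)
      (ModuleCat.of (Module.End R ω) ω) i)) (P P' : ProjPresentation R M) :
    IsTorsionfree ω P n ↔ IsTorsionfree ω P' n :=
  ⟨fun H i hi hin ↦ subsingleton_ext_transpose ω (hω i hi hin) P' P (H i hi hin),
    fun H i hi hin ↦ subsingleton_ext_transpose ω (hω i hi hin) P P' (H i hi hin)⟩

end PresentationIndependence

/-! ### Faithful dimension and self-extensions of `ω` over `End_R(ω)` -/

section FaithfulDimension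

open Abelian

variable {R : Type u} [Ring R] {ω : Type u} [AddCommGroup ω] [Module R ω]

lemma InAdd.pi {X : Type u} [AddCommGroup X] [Module R X] (h : InAdd R ω X) :
    ∃ (k : ℕ) (a : Fin k → X →ₗ[R] ω) (c : Fin k → ω →ₗ[R] X), ∑ j, c j ∘ₗ a j = LinearMap.id := by
  obtain ⟨k, i, p, hpi⟩ := h
  refine ⟨k, fun j ↦ LinearMap.proj j ∘ₗ i, fun j ↦ p ∘ₗ LinearMap.single R (fun _ ↦ ω) j, ?_⟩
  rw [← hpi]
  ext x
  simp only [LinearMap.sum_apply, LinearMap.comp_apply, LinearMap.proj_apply, ← map_sum]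
  congr 1
  ext j
  simp [Finset.sum_apply, Pi.single_apply]

lemma InAdd.self : InAdd R ω ω :=
  ⟨1, LinearMap.pi fun _ ↦ LinearMap.id, LinearMap.proj 0, by ext; simp⟩

/-- `ω` cogenerates `add ω`. -/
lemma InAdd.eq_zero {X : Type u} [AddCommGroup X] [Module R X] (h : InAdd R ω X) {x : X}
    (hx : ∀ φ : X →ₗ[R] ω, φ x = 0) : x = 0 := by
  obtain ⟨k, a, c, hac⟩ := h.pi
  rw [← LinearMap.id_apply (R := R) x, ← hac]
  simp [LinearMap.sum_apply, hx]

/-- Modules in `add ω` are `ω`-reflexive; this is the surjectivity of `X → X^{ωω}`. -/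
lemma InAdd.exists_evalDual {X : Type u} [AddCommGroup X] [Module R X] (h : InAdd R ω X)
    (ξ : (X →ₗ[R] ω) →ₗ[Module.End R ω] ω) : ∃ x : X, evalDual ω x = ξ := by
  obtain ⟨k, a, c, hac⟩ := h.pi
  refine ⟨∑ j, c j (ξ (a j)), LinearMap.ext fun φ ↦ ?_⟩
  have hφ : φ = ∑ j, (φ ∘ₗ c j : Module.End R ω) • a j := by
    conv_lhs => rw [← LinearMap.comp_id φ, ← hac]
    ext x
    simp [LinearMap.sum_apply]
  conv_rhs => rw [hφ]
  simp

/-- The dual of a module in `add ω` is projective over `End_R(ω)`. -/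
lemma InAdd.projective_dual {X : Type u} [AddCommGroup X] [Module R X] (h : InAdd R ω X) :
    Module.Projective (Module.End R ω) (X →ₗ[R] ω) := by
  obtain ⟨k, a, c, hac⟩ := h.pi
  let i : (X →ₗ[R] ω) →ₗ[Module.End R ω] (Fin k → Module.End R ω) :=
    { toFun := fun φ j ↦ φ ∘ₗ c j
      map_add' := fun _ _ ↦ rfl
      map_smul' := fun _ _ ↦ rfl }
  let p : (Fin k → Module.End R ω) →ₗ[Module.End R ω] (X →ₗ[R] ω) :=
    { toFun := fun t ↦ ∑ j, t j ∘ₗ a j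
      map_add' := fun t t' ↦ by simp [LinearMap.add_comp, Finset.sum_add_distrib]
      map_smul' := fun t t' ↦ by
        ext; simp [LinearMap.sum_apply] }
  refine Module.Projective.of_split i p (LinearMap.ext fun φ ↦ ?_)
  conv_rhs => rw [LinearMap.id_apply, ← LinearMap.comp_id φ, ← hac]
  ext x
  simp [i, p, LinearMap.sum_apply]

variable {X : ℕ → ModuleCat.{u} R} {f : ∀ i, X i →ₗ[R] X (i + 1)} {m : ℕ}

/-- Write `Kᵢ ⊆ X (i + 1)` for the range of `f i`. Along the sequence defining the faithful
dimension, `Kᵢ → Kᵢ^{ωω}` is surjective: an element of `Kᵢ^{ωω}` comes from some `x ∈ X (i + 1)` by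
reflexivity of `X (i + 1)`, and every functional on `X (i + 2)` kills `f (i + 1) x`. -/
lemma exists_evalDual_range (hexact : ∀ i, i + 1 < m → Function.Exact (f i) (f (i + 1)))
    (happ : ∀ i, i < m → IsLeftAddApproximation R ω (LinearMap.range (f i)).subtype)
    (i : ℕ) (hi : i + 1 < m) (ξ : (LinearMap.range (f i) →ₗ[R] ω) →ₗ[Module.End R ω] ω) :
    ∃ x : LinearMap.range (f i), evalDual ω x = ξ := by
  obtain ⟨x, hx⟩ := (happ i (by omega)).1.exists_evalDual
    (ξ ∘ₗ dualMap ω (LinearMap.range (f i)).subtype)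
  have hx' : ∀ φ : X (i + 1) →ₗ[R] ω, φ x = ξ (φ ∘ₗ (LinearMap.range (f i)).subtype) :=
    fun φ ↦ LinearMap.congr_fun hx φ
  have hfx : f (i + 1) x = 0 := (happ (i + 1) hi).1.eq_zero fun φ ↦ by
    rw [← LinearMap.comp_apply, hx', show (φ ∘ₗ f (i + 1)) ∘ₗ (LinearMap.range (f i)).subtype = 0
      from ?_, map_zero]
    ext ⟨_, y, rfl⟩
    simp [(hexact i hi).apply_apply_eq_zero]
  refine ⟨⟨x, ((hexact i hi) x).mp hfx⟩, LinearMap.ext fun ψ ↦ ?_⟩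
  obtain ⟨φ, rfl⟩ := (happ i (by omega)).2 ω InAdd.self ψ
  exact hx' φ

/-- Vanishing of `Extʲ⁺¹(Kᵢ^ω, ω)`, by shifting from `Kᵢ^ω` to `Kᵢ₊₁^ω` until `Ext¹` is reached;
there it says that every map `Kᵢ₊₁^ω → ω` extends to `X (i + 1)^ω`, which holds as the map is an
evaluation. -/
lemma subsingleton_ext_dual_range (hexact : ∀ i, i + 1 < m → Function.Exact (f i) (f (i + 1)))
    (happ : ∀ i, i < m → IsLeftAddApproximation R ω (LinearMap.range (f i)).subtype)
    (j i : ℕ) (hi : i + j + 2 < m) :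
    Subsingleton (Ext.{u} (ModuleCat.of (Module.End R ω) (LinearMap.range (f i) →ₗ[R] ω))
      (ModuleCat.of (Module.End R ω) ω) (j + 1)) := by
  -- Dualising `0 → Kᵢ → X (i + 1) → Kᵢ₊₁ → 0` gives a short exact sequence with projective middle
  -- term.
  have hproj := (happ i (by omega)).1.projective_dual
  have hinj : Function.Injective (dualMap ω (f (i + 1)).rangeRestrict) := fun φ ψ h ↦
    (LinearMap.cancel_right (f (i + 1)).surjective_rangeRestrict).mp h
  have hsurj : Function.Surjective (dualMap ω (LinearMap.range (f i)).subtype) :=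
    (happ i (by omega)).2 ω InAdd.self
  have hex : Function.Exact (dualMap ω (f (i + 1)).rangeRestrict)
      (dualMap ω (LinearMap.range (f i)).subtype) := by
    intro φ
    constructor
    · intro hφ
      -- `φ` vanishes on `Kᵢ = ker (f (i + 1))`, so it descends to `Kᵢ₊₁`.
      have hker : LinearMap.ker (f (i + 1)).rangeRestrict ≤ LinearMap.ker φ := fun x hx ↦ by
        rw [LinearMap.ker_rangeRestrict, (hexact i (by omega)).linearMap_ker_eq] at hx
        exact LinearMap.congr_fun hφ ⟨x, hx⟩
      refine ⟨(LinearMap.ker (f (i + 1)).rangeRestrict).liftQ φ hker ∘ₗ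
        ((f (i + 1)).rangeRestrict.quotKerEquivOfSurjective
          (f (i + 1)).surjective_rangeRestrict).symm.toLinearMap, LinearMap.ext fun x ↦ ?_⟩
      have : ((f (i + 1)).rangeRestrict.quotKerEquivOfSurjective
          (f (i + 1)).surjective_rangeRestrict).symm ((f (i + 1)).rangeRestrict x) =
          Submodule.Quotient.mk x := by
        rw [LinearEquiv.symm_apply_eq]; rfl
      simp [this]
    · rintro ⟨ψ, rfl⟩
      ext ⟨_, y, rfl⟩
      have : (f (i + 1)).rangeRestrict (f i y) = 0 :=
        Subtype.ext ((hexact i (by omega)).apply_apply_eq_zero y)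
      simp [this]
  cases j with
  | zero =>
    rw [subsingleton_ext_one_iff hinj hex hsurj]
    intro ξ
    obtain ⟨⟨_, x, rfl⟩, rfl⟩ := exists_evalDual_range hexact happ (i + 1) (by omega) ξ
    exact ⟨evalDual ω x, rfl⟩
  | succ j =>
    rw [subsingleton_ext_succ_iff hinj hex hsurj]
    exact subsingleton_ext_dual_range hexact happ j (i + 1) (by omega)

/-- If `fadim ω ≥ n + 2`, then `Extⁱ(ω, ω) = 0` over `End_R(ω)` for `1 ≤ i ≤ n`: dualising the
defining sequence of the faithful dimension gives the beginning of a projective resolution of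
`ω = R^ω`, and dualising once more gives back the sequence. -/
theorem FaithfulDimGE.subsingleton_ext {n : ℕ} (h : FaithfulDimGE R ω (n + 2)) (i : ℕ) (hi : 1 ≤ i)
    (hin : i ≤ n) : Subsingleton (Ext.{u} (ModuleCat.of (Module.End R ω) ω)
      (ModuleCat.of (Module.End R ω) ω) i) := by
  obtain ⟨X, e, f, hf, hexact, happ⟩ := h
  obtain ⟨j, rfl⟩ := Nat.exists_eq_add_of_le' hi
  let e' : R ≃ₗ[R] LinearMap.range (f 0) := e.trans (LinearEquiv.ofInjective (f 0) hf)
  let E : (LinearMap.range (f 0) →ₗ[R] ω) ≃ₗ[Module.End R ω] ω :=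
    { evalDual ω (e' 1) with
      invFun := fun w ↦ LinearMap.toSpanSingleton R ω w ∘ₗ e'.symm.toLinearMap
      left_inv := fun φ ↦ by
        ext x
        obtain ⟨r, rfl⟩ := e'.surjective x
        simp [← map_smul]
      right_inv := fun w ↦ by simp }
  exact subsingleton_ext_of_linearEquiv E.symm
    (subsingleton_ext_dual_range hexact happ j 0 (by omega))

end FaithfulDimension

/-! ### Restriction of presentations to the base ring -/

section RestrictionOfPresentations

variable {R S : Type u} [Ring R] [Ring S]

lemma projective_restrictScalars [Module R S] [IsScalarTower R S S] [Module.Projective R S]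
    {P : Type u} [AddCommGroup P] [Module R P] [Module S P] [IsScalarTower R S P]
    [Module.Finite S P] [Module.Projective S P] : Module.Projective R P := by
  obtain ⟨k, p, i, -, -, hpi⟩ := Module.Finite.exists_comp_eq_id_of_projective S P
  have : Module.Projective R (Fin k → S) := by
    classical
    exact Module.Projective.of_equiv ((Finsupp.linearEquivFunOnFinite R S (Fin k)).symm.trans
      (finsuppLequivDFinsupp R)).symm
  exact Module.Projective.of_split (i.restrictScalars R) (p.restrictScalars R)
    (LinearMap.ext fun x ↦ LinearMap.congr_fun hpi x)

/-- A presentation over `S`, viewed over `R` through `l : R → S`, when `_R S` is finitely generated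
projective. -/
def ProjPresentation.restrictScalars (l : R →+* S)
    (hfin : letI : Module R S := Module.compHom S l; Module.Finite R S)
    (hproj : letI : Module R S := Module.compHom S l; Module.Projective R S)
    {M : Type u} [AddCommGroup M] [Module S M] [Module R M]
    (hM : ∀ (r : R) (m : M), r • m = l r • m) (P : ProjPresentation S M) : ProjPresentation R M :=
  letI : Module R S := Module.compHom S l
  letI : Module R P.P₁ := Module.compHom P.P₁ l
  letI : Module R P.P₀ := Module.compHom P.P₀ l
  haveI : IsScalarTower R S S := ⟨fun r s x ↦ mul_assoc (l r) s x⟩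
  haveI : IsScalarTower R S P.P₁ := ⟨fun r s x ↦ mul_smul (l r) s x⟩
  haveI : IsScalarTower R S P.P₀ := ⟨fun r s x ↦ mul_smul (l r) s x⟩
  haveI := P.finite₁
  haveI := P.finite₀
  haveI := P.projective₁
  haveI := P.projective₀
  { P₁ := ModuleCat.of R P.P₁
    P₀ := ModuleCat.of R P.P₀
    finite₁ := Module.Finite.trans S P.P₁
    finite₀ := Module.Finite.trans S P.P₀
    projective₁ := projective_restrictScalars (S := S)
    projective₀ := projective_restrictScalars (S := S)
    d := { toFun := P.d, map_add' := map_add P.d, map_smul' := fun r ↦ map_smul P.d (l r) }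
    aug :=
      { toFun := P.aug
        map_add' := map_add P.aug
        map_smul' := fun r x ↦ (map_smul P.aug (l r) x).trans (hM r _).symm }
    exact := P.exact
    surjective := P.surjective }

end RestrictionOfPresentations

/-! ### Transposes with respect to a coinduced module -/

section TransposesAndCoinduction

namespace IsCoinduced

variable {R S : Type u} [Ring R] [Ring S] {l : R →+* S} {V W : Type u}
    [AddCommGroup V] [Module S V] [AddCommGroup W] [Module R W] {θ : V →+ W}

/-- If `V` is coinduced from `W`, the transposes with respect to `V` and to `W` computed from the
same presentation agree: `Hom_S(P, V) = Hom_R(P, W)` for every `S`-module `P`. -/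
lemma nonempty_transpose_equiv (hc : IsCoinduced l θ) {P₁ P₀ : Type u} [AddCommGroup P₁]
    [AddCommGroup P₀] [Module S P₁] [Module S P₀] [Module R P₁] [Module R P₀]
    (h₁ : ∀ (r : R) (x : P₁), r • x = l r • x) (h₀ : ∀ (r : R) (x : P₀), r • x = l r • x)
    (d : P₁ →ₗ[S] P₀) (d' : P₁ →ₗ[R] P₀) (hd : ∀ x, d' x = d x)
    [Module (Module.End R W) ((P₁ →ₗ[S] V) ⧸ LinearMap.range (dualMap V d))]
    (hY : ∀ (t : Module.End R W) (y : (P₁ →ₗ[S] V) ⧸ LinearMap.range (dualMap V d)),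
      t • y = hc.endHom t • y) :
    Nonempty (((P₁ →ₗ[R] W) ⧸ LinearMap.range (dualMap W d')) ≃ₗ[Module.End R W]
      ((P₁ →ₗ[S] V) ⧸ LinearMap.range (dualMap V d))) := by
  choose e he using fun h : P₁ →ₗ[R] W ↦ hc.exists_lift h₁ h
  have hcomp : ∀ g : P₁ →ₗ[S] V, e (hc.comp h₁ g) = g := fun g ↦ hc.hom_ext fun x ↦ he _ x
  let F : (P₁ →ₗ[R] W) →ₗ[Module.End R W] ((P₁ →ₗ[S] V) ⧸ LinearMap.range (dualMap V d)) :=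
    { toFun := fun h ↦ Submodule.Quotient.mk (e h)
      map_add' := fun h h' ↦ by
        rw [← Submodule.Quotient.mk_add]
        exact congrArg _ (hc.hom_ext fun x ↦ by simp [he])
      map_smul' := fun t h ↦ by
        rw [RingHom.id_apply, hY, ← Submodule.Quotient.mk_smul]
        exact congrArg _ (hc.hom_ext fun x ↦ by simp [he]) }
  have hF : Function.Surjective F := fun y ↦ by
    obtain ⟨g, rfl⟩ := Submodule.mkQ_surjective _ y
    exact ⟨hc.comp h₁ g, congrArg _ (hcomp g)⟩
  have hker : LinearMap.range (dualMap W d') = LinearMap.ker F := by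
    ext h
    rw [LinearMap.mem_ker, LinearMap.mem_range]
    change _ ↔ Submodule.Quotient.mk (e h) = 0
    rw [Submodule.Quotient.mk_eq_zero, LinearMap.mem_range]
    constructor
    · rintro ⟨k, rfl⟩
      obtain ⟨k', hk'⟩ := hc.exists_lift h₀ k
      exact ⟨k', hc.hom_ext fun x ↦ by simp [he, hk', hd]⟩
    · rintro ⟨k, hk⟩
      refine ⟨hc.comp h₀ k, LinearMap.ext fun x ↦ ?_⟩
      rw [← he h, ← hk, dualMap_apply, LinearMap.comp_apply, hd]
      rfl
  exact ⟨(Submodule.quotEquivOfEq _ _ hker).trans (F.quotKerEquivOfSurjective hF)⟩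

/-- Relative torsionfreeness is unchanged when passing from `(S, V)` to `(R, W)` and restricting the
presentation. -/
theorem isTorsionfree_iff (hc : IsCoinduced l θ) (r : AddRetract l V W)
    (hfin : letI : Module R S := Module.compHom S l; Module.Finite R S)
    (hproj : letI : Module R S := Module.compHom S l; Module.Projective R S)
    {M : Type u} [AddCommGroup M] [Module S M] [Module R M]
    (hM : ∀ (r : R) (m : M), r • m = l r • m) (P : ProjPresentation S M) (n : ℕ) :
    IsTorsionfree V P n ↔ IsTorsionfree W (P.restrictScalars l hfin hproj hM) n := by
  let P' := P.restrictScalars l hfin hproj hM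
  let _ : Module R P.P₁ := Module.compHom P.P₁ l
  let _ : Module R P.P₀ := Module.compHom P.P₀ l
  let _ : Module (Module.End R W) (Transpose V P) := Module.compHom _ hc.endHom
  obtain ⟨e⟩ := hc.nonempty_transpose_equiv (fun _ _ ↦ rfl) (fun _ _ ↦ rfl) P.d P'.d (fun _ ↦ rfl)
    (fun _ _ ↦ rfl)
  refine forall_congr' fun i ↦ forall_congr' fun hi ↦ forall_congr' fun _ ↦ ?_
  obtain ⟨j, rfl⟩ := Nat.exists_eq_add_of_le' hi
  rw [(hc.endHom_isCoinduced r).subsingleton_ext_iff (hc.projective_end r) j (Transpose V P)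
    fun _ _ ↦ rfl]
  exact ⟨subsingleton_ext_of_linearEquiv e, subsingleton_ext_of_linearEquiv e.symm⟩

end IsCoinduced

end TransposesAndCoinduction

end RelTorsionfree

theorem theorem4p4
    {R S : Type u} [Ring R] [Ring S]
    [IsNoetherianRing R] [IsNoetherianRing Rᵐᵒᵖ] [IsNoetherianRing S] [IsNoetherianRing Sᵐᵒᵖ]
    (l : R →+* S)
    (hFrob : RelTorsionfree.IsFrobeniusExtension l)
    (hCentral : RelTorsionfree.IsCentrallyProjective l)
    (n : ℕ)
    (ω : Type u) [AddCommGroup ω] [Module R ω] [Module.Finite R ω]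
    (hfadim : RelTorsionfree.FaithfulDimGE R ω (n + 2))
    (hExt : ∀ i : ℕ, 1 ≤ i → i ≤ n →
      Subsingleton (Abelian.Ext.{u} (ModuleCat.of R ω) (ModuleCat.of R ω) i))
    (M : Type u) [AddCommGroup M] [Module S M] [Module.Finite S M]
    -- the underlying `R`-module of `M`
    [Module R M] (hM : ∀ (r : R) (m : M), r • m = l r • m)
    -- the transposes may be computed from any presentations
    (PS : RelTorsionfree.ProjPresentation S M) (PR : RelTorsionfree.ProjPresentation R M) :
    RelTorsionfree.IsTorsionfree (RelTorsionfree.BaseChange l ω) PS n ↔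
      RelTorsionfree.IsTorsionfree ω PR n := by
  obtain ⟨θ, hc⟩ := hFrob.exists_isCoinduced ω
  obtain ⟨r⟩ := hCentral.nonempty_addRetract ω
  obtain ⟨hfin, hproj, -⟩ := hFrob
  rw [hc.isTorsionfree_iff r hfin hproj hM PS n]
  exact RelTorsionfree.isTorsionfree_congr ω hfadim.subsingleton_ext _ _
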